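/- Logarithms are to base $2$. A spectral point is a function $f$ assigning to every finite simple graph a nonnegative real number such that $f(G\sqcup H)=f(G)+f(H)$, $f(G\boxtimes H)=f(G)f(H)$ (strong product), $f(H)\le f(G)$ whenever there is a graph homomorphism $\overline{H}\to\overline{G}$ between the complements, and $f(\overline{K_d})=d$. For a finite graph $G$ and a probability distribution $P$ on $V(G)$, the (logarithmic) probabilistic refinement of $f$ is $$F(G,P)=\lim_{n\to\infty}\frac1n\log f\big(G^{\boxtimes n}[T_{Q_n}]\big),$$ where $(Q_n)_{n\ge1}$ is any sequence of distributions converging to $P$ such that $Q_n$ is the type (empirical distribution) of some string in $V(G)^n$, and $G^{\boxtimes n}[T_{Q_n}]$ is the subgraph of the strong power $G^{\boxtimes n}$ induced on the set $T_{Q_n}$ of strings of type $Q_n$. (The limit exists and does not depend on the choice of the sequence.) Proposition. Let $G$ be a finite simple graph, let $\mu$ be a stationary probability measure on $V(G)^\infty$, i.e. its marginals satisfy $\mu_{m+1,\ldots,m+n}=\mu_{1\ldots n}$ for all $m,n$, and let $f$ be a spectral point. For every $n$ the value $F(G^{\boxtimes n},\mu_{1\ldots n})$ is well defined by the above limit,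 and the $F$-rate exists and equals the infimum: $$\overline F(G,\mu):=\lim_{n\to\infty}\frac1nF(G^{\boxtimes n},\mu_{1\ldots n})=\inf_{n\ge1}\frac1nF(G^{\boxtimes n},\mu_{1\ldots n}).$$ Moreover, let $H$ denote Shannon entropy and put $b_n=H(\mu_{1\ldots n})-F(G^{\boxtimes n},\mu_{1\ldots n})$. Then $b_n\ge0$ for all $n$, the entropy rate $\overline H(\mu)=\lim_{n\to\infty}\frac1nH(\mu_{1\ldots n})$ exists, and $$\overline F(G,\mu)=\overline H(\mu)-\lim_{n\to\infty}\frac{b_n}{n}=\overline H(\mu)-\inf_{n\ge1}\frac{b_n}{n}=\sup_{n\ge1}\Big[\overline H(\mu)-\frac1n\big(H(\mu_{1\ldots n})-F(G^{\boxtimes n},\mu_{1\ldots n})\big)\Big],$$ where in particular $\lim_{n\to\infty}b_n/n$ exists. -/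

import Mathlib

open Filter Topology MeasureTheory

universe u

noncomputable section

namespace AmbiguousSource

/-- The strong product `G ⊠ H`: distinct pairs are adjacent iff in both coordinates the entries
are adjacent or equal. -/
def strongProd {V W : Type u} (G : SimpleGraph V) (H : SimpleGraph W) : SimpleGraph (V × W) where
  Adj x y := x ≠ y ∧ (x.1 = y.1 ∨ G.Adj x.1 y.1) ∧ (x.2 = y.2 ∨ H.Adj x.2 y.2)
  symm := ⟨fun _ _ h => ⟨h.1.symm, h.2.1.imp Eq.symm (fun h => h.symm),
    h.2.2.imp Eq.symm (fun h => h.symm)⟩⟩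
  loopless := ⟨fun _ h => h.1 rfl⟩

/-- The strong power `G^{⊠ n}` on strings of length `n`: distinct strings are adjacent iff in every
coordinate the letters are adjacent or equal. -/
def strongPow {V : Type u} (G : SimpleGraph V) (n : ℕ) : SimpleGraph (Fin n → V) where
  Adj x y := x ≠ y ∧ ∀ i, x i = y i ∨ G.Adj (x i) (y i)
  symm := ⟨fun _ _ h => ⟨h.1.symm, fun i => (h.2 i).imp Eq.symm (fun h => h.symm)⟩⟩
  loopless := ⟨fun _ h => h.1 rfl⟩

/-- A spectral point: an element of the asymptotic spectrum of (finite) graphs. In `mono`, a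
homomorphism between complements is a map sending distinguishable pairs to distinguishable pairs;
in particular the parameter is invariant under graph isomorphism. In `edgeless`, `⊥` is the
edgeless graph on `V`. -/
structure SpectralPoint where
  /-- The value of the parameter on a finite graph. -/
  val : {V : Type u} → [Finite V] → SimpleGraph V → ℝ
  nonneg : ∀ {V : Type u} [Finite V] (G : SimpleGraph V), 0 ≤ val G
  disjUnion : ∀ {V W : Type u} [Finite V] [Finite W] (G : SimpleGraph V) (H : SimpleGraph W),
    val (G.sum H) = val G + val H
  strong : ∀ {V W : Type u} [Finite V] [Finite W] (G : SimpleGraph V) (H : SimpleGraph W),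
    val (strongProd G H) = val G * val H
  mono : ∀ {V W : Type u} [Finite V] [Finite W] (H : SimpleGraph V) (G : SimpleGraph W),
    Nonempty (Hᶜ →g Gᶜ) → val H ≤ val G
  edgeless : ∀ {V : Type u} [Finite V], val (⊥ : SimpleGraph V) = Nat.card V

/-- The type (empirical distribution) of a string: the relative frequency of each letter. -/
def stringType {V : Type u} {n : ℕ} (x : Fin n → V) : V → ℝ :=
  fun a => (Set.ncard {i | x i = a} : ℝ) / n

/-- `Q` is an `n`-type: the type of some string of length `n`. -/
def IsNType {V : Type u} (n : ℕ) (Q : V → ℝ) : Prop :=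
  ∃ x : Fin n → V, stringType x = Q

/-- The type class of `Q`: the strings of length `n` and type `Q`. -/
def typeClass {V : Type u} (n : ℕ) (Q : V → ℝ) : Set (Fin n → V) :=
  {x | stringType x = Q}

/-- `L` is the value at `(G, P)` of the (logarithmic) probabilistic refinement of `f`: for every
sequence of `n`-types `Q n` converging to `P`, the normalized logarithms (to base 2) of `f`
evaluated at the subgraph of `G^{⊠ n}` induced on the type class of `Q n` converge to `L`. -/
def IsProbRefinement (f : SpectralPoint.{u}) {V : Type u} [Finite V] (G : SimpleGraph V)
    (P : V → ℝ) (L : ℝ) : Prop :=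
  ∀ Q : ℕ → V → ℝ, (∀ n, 0 < n → IsNType n (Q n)) → Tendsto Q atTop (𝓝 P) →
    Tendsto (fun n : ℕ => Real.logb 2 (f.val ((strongPow G n).induce (typeClass n (Q n)))) / n)
      atTop (𝓝 L)

/-- The probabilistic refinement `F(G, P)` of the spectral point `f`. -/
def probRefinement (f : SpectralPoint.{u}) {V : Type u} [Finite V] (G : SimpleGraph V)
    (P : V → ℝ) : ℝ :=
  Classical.epsilon (IsProbRefinement f G P)

/-- The marginal `μ_{m+1, …, m+n}` of a distribution on infinite words, as a probability mass
function on strings of length `n`. (Letters are indexed from `0` here.) -/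
def blockMarginal {V : Type u} [MeasurableSpace V] (μ : Measure (ℕ → V)) (m n : ℕ) :
    (Fin n → V) → ℝ :=
  fun x => μ.real {ω | ∀ i : Fin n, ω (m + i) = x i}

/-- The source `μ` is stationary: `μ_{m+1, …, m+n} = μ_{1, …, n}` for all `m`, `n`. -/
def IsStationary {V : Type u} [MeasurableSpace V] (μ : Measure (ℕ → V)) : Prop :=
  ∀ m n : ℕ, blockMarginal μ m n = blockMarginal μ 0 n

/-- The Shannon entropy (in bits) of a probability mass function on a finite set. -/
def entropy {X : Type u} [Fintype X] (P : X → ℝ) : ℝ :=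
  ∑ x, -(P x * Real.logb 2 (P x))

/-- The entropy `H(μ_{1…n})` of the initial segment of length `n`. -/
def blockEntropy {V : Type u} [Fintype V] [MeasurableSpace V] (μ : Measure (ℕ → V)) (n : ℕ) : ℝ :=
  entropy (blockMarginal μ 0 n)

/-- `F(G^{⊠ n}, μ_{1…n})`. -/
def blockF (f : SpectralPoint.{u}) {V : Type u} [Finite V] [MeasurableSpace V]
    (G : SimpleGraph V) (μ : Measure (ℕ → V)) (n : ℕ) : ℝ :=
  probRefinement f (strongPow G n) (blockMarginal μ 0 n)

/-- The `F`-rate of `(G, μ)`: the limit of `F(G^{⊠ n}, μ_{1…n}) / n`. -/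
def FRate (f : SpectralPoint.{u}) {V : Type u} [Finite V] [MeasurableSpace V]
    (G : SimpleGraph V) (μ : Measure (ℕ → V)) : ℝ :=
  limUnder atTop (fun n : ℕ => blockF f G μ n / n)

/-- The entropy rate of `μ`: the limit of `H(μ_{1…n}) / n`. -/
def entropyRate {V : Type u} [Fintype V] [MeasurableSpace V] (μ : Measure (ℕ → V)) : ℝ :=
  limUnder atTop (fun n : ℕ => blockEntropy μ n / n)

end AmbiguousSource

end

/-!
The value `F(G, P)` is computed along integer letter counts `k n` with `k n / n → P`, for which `f`
is superadditive, so that Fekete's lemma applies. Now let `K` be an induced subgraph of `G₁ ⊠ G₂`,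
and let `P₁`, `P₂` be the marginals of a distribution `P` on the vertices of `K`. A string over `K`
with given letter counts is a pair of strings with the marginal letter counts, whence
`F(K, P) ≤ F(G₁, P₁) + F(G₂, P₂)`. The graph of all such pairs is vertex-transitive, so it is
covered by few translates of the graph of those pairs that come from `K`; up to subexponential
factors their number is the ratio of the numbers of vertices. Hence
`F(G₁, P₁) + F(G₂, P₂) ≤ F(K, P) + H(P₁) + H(P₂) - H(P)`.

For `G^{⊠ (m + n)} = G^{⊠ m} ⊠ G^{⊠ n}` and a stationary source, the two inequalities say that
`F(G^{⊠ n}, μ_{1…n})` and `H(μ_{1…n}) - F(G^{⊠ n}, μ_{1…n})` are subadditive in `n`. Both are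
nonnegative, so Fekete's lemma gives their rates, and the entropy rate is the sum of the two.
-/

noncomputable section

namespace AmbiguousSource

open Finset

open scoped Pointwise

section Covering

variable {Γ X : Type*} [Group Γ] [MulAction Γ X] [Fintype X] [DecidableEq X]

lemma card_filter_smul_eq_mul_card [Fintype Γ] [MulAction.IsPretransitive Γ X] (x y : X) :
    #{g : Γ | g • x = y} * Fintype.card X = Fintype.card Γ := by
  obtain ⟨h, rfl⟩ := MulAction.exists_smul_eq Γ x y
  have hcoset : #{g : Γ | g • x = h • x} = Nat.card (MulAction.stabilizer Γ x) := by
    rw [Nat.card_eq_fintype_card, Fintype.card_subtype]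
    refine card_bijective (h⁻¹ * ·) (Group.mulLeft_bijective h⁻¹) fun g => ?_
    simp [mul_smul, inv_smul_eq_iff]
  rw [hcoset, ← Nat.card_eq_fintype_card, ← MulAction.index_stabilizer_of_transitive Γ x,
    Subgroup.card_mul_index, Nat.card_eq_fintype_card]

lemma sum_card_smul_inter_mul_card [Fintype Γ] [MulAction.IsPretransitive Γ X] (T U : Finset X) :
    (∑ g : Γ, #(g • T ∩ U)) * Fintype.card X = ∑ _g : Γ, #T * #U := by
  have hinter (g : Γ) : #(g • T ∩ U) = ∑ t ∈ T, ∑ u ∈ U, if g • t = u then 1 else 0 := by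
    have himage : g • T ∩ U = {t ∈ T | g • t ∈ U}.image (g • ·) := by
      rw [smul_finset_def, ← filter_mem_eq_inter, filter_image]
    rw [himage, card_image_of_injective _ (MulAction.injective g), card_filter]
    simp only [sum_ite_eq]
  calc (∑ g : Γ, #(g • T ∩ U)) * Fintype.card X
      = ∑ t ∈ T, ∑ u ∈ U, #{g : Γ | g • t = u} * Fintype.card X := by
        simp only [hinter, card_filter, ← sum_mul]
        rw [sum_comm, sum_congr rfl fun t _ => sum_comm]
    _ = ∑ _g : Γ, #T * #U := by
        simp only [card_filter_smul_eq_mul_card, sum_const, smul_eq_mul, card_univ]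
        ring

lemma exists_card_mul_card_le_card_smul_inter [Finite Γ] [MulAction.IsPretransitive Γ X]
    (T U : Finset X) : ∃ g : Γ, #T * #U ≤ #(g • T ∩ U) * Fintype.card X := by
  have := Fintype.ofFinite Γ
  have hsum := (sum_card_smul_inter_mul_card (Γ := Γ) T U).ge
  rw [sum_mul] at hsum
  simpa using exists_le_of_sum_le univ_nonempty hsum

lemma exists_card_compl_smul_le [Finite Γ] [MulAction.IsPretransitive Γ X]
    (T : Finset X) (N : ℕ) : ∃ A : Finset Γ, #A ≤ N ∧
      (#(A • T)ᶜ : ℝ) ≤ Fintype.card X * (1 - #T / Fintype.card X) ^ N := by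
  classical
  induction N with
  | zero => exact ⟨∅, by simp⟩
  | succ N ih =>
    obtain ⟨A, hA, hcompl⟩ := ih
    obtain ⟨g, hg⟩ := exists_card_mul_card_le_card_smul_inter (Γ := Γ) T (A • T)ᶜ
    refine ⟨insert g A, (card_insert_le g A).trans (by lia), ?_⟩
    have hcard : (#(insert g A • T)ᶜ : ℝ) = #(A • T)ᶜ - #(g • T ∩ (A • T)ᶜ) := by
      rw [insert_eq, union_smul, singleton_smul, compl_union, inter_comm, ← sdiff_eq_inter_compl,
        eq_sub_iff_add_eq', inter_comm]
      exact_mod_cast card_inter_add_card_sdiff (A • T)ᶜ (g • T)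
    have hdensity : (#T / Fintype.card X : ℝ) ≤ 1 :=
      div_le_one_of_le₀ (by exact_mod_cast card_le_univ T) (Nat.cast_nonneg _)
    have hcovered : (#T / Fintype.card X : ℝ) * #(A • T)ᶜ ≤ #(g • T ∩ (A • T)ᶜ) := by
      rw [div_mul_eq_mul_div]
      exact div_le_of_le_mul₀ (Nat.cast_nonneg _) (Nat.cast_nonneg _) (by exact_mod_cast hg)
    calc (#(insert g A • T)ᶜ : ℝ) ≤ #(A • T)ᶜ * (1 - #T / Fintype.card X) := by linarith
      _ ≤ Fintype.card X * (1 - #T / Fintype.card X) ^ (N + 1) := by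
        rw [pow_succ, ← mul_assoc]
        exact mul_le_mul_of_nonneg_right hcompl (sub_nonneg.2 hdensity)

/-- Since `1 - t ≤ exp (-t)`, about `log |X| / t` greedily chosen translates of a set of density
`t` leave less than one point uncovered. -/
lemma exists_smul_eq_univ [Finite Γ] [MulAction.IsPretransitive Γ X]
    {T : Finset X} (hT : T.Nonempty) : ∃ A : Finset Γ, A • T = univ ∧
      (#A * #T : ℝ) ≤ Fintype.card X * (1 + Real.log (Fintype.card X)) := by
  have hTpos : (0 : ℝ) < #T := by exact_mod_cast hT.card_pos
  have hTX : (#T : ℝ) ≤ Fintype.card X := by exact_mod_cast card_le_univ T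
  set M : ℝ := (Fintype.card X : ℝ)
  have hM : 0 < M := hTpos.trans_le hTX
  have hlog : 0 ≤ Real.log M := Real.log_natCast_nonneg _
  set N := ⌊Real.log M * M / #T⌋₊ + 1 with hN
  obtain ⟨A, hA, hcompl⟩ := exists_card_compl_smul_le (Γ := Γ) T N
  refine ⟨A, ?_, ?_⟩
  · have hN_gt : Real.log M < N * (#T / M) := by
      rw [← div_lt_iff₀ (by positivity), div_div_eq_mul_div, hN]
      exact_mod_cast Nat.lt_floor_add_one _
    have hlt : (#(A • T)ᶜ : ℝ) < 1 := by
      calc (#(A • T)ᶜ : ℝ) ≤ M * (1 - #T / M) ^ N := hcompl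
        _ ≤ M * Real.exp (-(#T / M)) ^ N := by
          gcongr
          · exact sub_nonneg.2 (div_le_one_of_le₀ hTX hM.le)
          · exact Real.one_sub_le_exp_neg _
        _ = Real.exp (Real.log M - N * (#T / M)) := by
          rw [sub_eq_add_neg, Real.exp_add, Real.exp_log hM, ← Real.exp_nat_mul, mul_neg]
        _ < 1 := Real.exp_lt_one_iff.2 (by linarith)
    rw [← compl_eq_empty_iff, ← card_eq_zero]
    exact_mod_cast Nat.lt_one_iff.1 (by exact_mod_cast hlt)
  · have hN_le : (N : ℝ) ≤ Real.log M * M / #T + 1 := by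
      rw [hN]; push_cast; gcongr; exact Nat.floor_le (by positivity)
    calc (#A * #T : ℝ) ≤ (Real.log M * M / #T + 1) * #T := by
          gcongr; exact le_trans (by exact_mod_cast hA) hN_le
      _ = Real.log M * M + #T := by field_simp
      _ ≤ M * (1 + Real.log M) := by linarith

end Covering

section Confusable

variable {V W : Type*}

/-- Two vertices are confusable if they are equal or adjacent: the reflexive closure of adjacency,
in terms of which both the strong product and monotonicity of spectral points are coordinatewise
conditions. -/
def Confusable (G : SimpleGraph V) (x y : V) : Prop :=
  x = y ∨ G.Adj x y

lemma adj_iff_ne_and_confusable {G : SimpleGraph V} {x y : V} :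
    G.Adj x y ↔ x ≠ y ∧ Confusable G x y :=
  ⟨fun h => ⟨h.ne, Or.inr h⟩, fun h => h.2.resolve_left h.1⟩

lemma confusable_bot {x y : V} : Confusable ⊥ x y ↔ x = y := by
  simp [Confusable]

lemma confusable_embedding_iff {G : SimpleGraph V} {H : SimpleGraph W} (φ : G ↪g H) {x y : V} :
    Confusable H (φ x) (φ y) ↔ Confusable G x y :=
  or_congr φ.injective.eq_iff φ.map_adj_iff

lemma confusable_induce {G : SimpleGraph V} {S : Set V} {x y : S} :
    Confusable (G.induce S) x y ↔ Confusable G (x : V) y :=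
  (confusable_embedding_iff (SimpleGraph.Embedding.induce S)).symm

lemma confusable_strongProd {V W : Type u} {G : SimpleGraph V} {H : SimpleGraph W} {x y : V × W} :
    Confusable (strongProd G H) x y ↔ Confusable G x.1 y.1 ∧ Confusable H x.2 y.2 := by
  refine ⟨?_, fun h => or_iff_not_imp_left.2 fun hxy => ⟨hxy, h⟩⟩
  rintro (rfl | h)
  exacts [⟨Or.inl rfl, Or.inl rfl⟩, h.2]

lemma confusable_strongPow {V : Type u} {G : SimpleGraph V} {n : ℕ} {x y : Fin n → V} :
    Confusable (strongPow G n) x y ↔ ∀ i, Confusable G (x i) (y i) := by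
  refine ⟨?_, fun h => or_iff_not_imp_left.2 fun hxy => ⟨hxy, h⟩⟩
  rintro (rfl | h)
  exacts [fun _ => Or.inl rfl, h.2]

/-- The graph embedding given by an injection that preserves and reflects confusability. -/
def embeddingOfConfusable {G : SimpleGraph V} {H : SimpleGraph W} (φ : V → W)
    (hφ : Function.Injective φ) (h : ∀ x y, Confusable H (φ x) (φ y) ↔ Confusable G x y) :
    G ↪g H where
  toFun := φ
  inj' := hφ
  map_rel_iff' := by simp [adj_iff_ne_and_confusable, h, hφ.eq_iff]

/-- The graph isomorphism given by a bijection that preserves and reflects confusability. -/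
def isoOfConfusable {G : SimpleGraph V} {H : SimpleGraph W} (e : V ≃ W)
    (h : ∀ x y, Confusable H (e x) (e y) ↔ Confusable G x y) : G ≃g H where
  toEquiv := e
  map_rel_iff' := by simp [adj_iff_ne_and_confusable, h]

lemma confusable_iso_iff {G : SimpleGraph V} {H : SimpleGraph W} (e : G ≃g H) {x y : V} :
    Confusable H (e x) (e y) ↔ Confusable G x y :=
  confusable_embedding_iff e.toEmbedding

/-- The isomorphism `G^{⊠ (m + n)} ≃ G^{⊠ m} ⊠ G^{⊠ n}` splitting a string into its first `m` and
its last `n` letters. -/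
def strongPowAddIso {V : Type u} (G : SimpleGraph V) (m n : ℕ) :
    strongPow G (m + n) ≃g strongProd (strongPow G m) (strongPow G n) :=
  isoOfConfusable (Fin.appendEquiv m n).symm fun x y => by
    simp [confusable_strongProd, confusable_strongPow, Fin.forall_fin_add]

end Confusable

section VertexTransitive

/-- A graph is vertex-transitive if its automorphism group acts transitively on the vertices. -/
def IsVertexTransitive {V : Type*} (G : SimpleGraph V) : Prop :=
  MulAction.IsPretransitive (G ≃g G) V

lemma IsVertexTransitive.strongProd {V W : Type u} {G : SimpleGraph V} {H : SimpleGraph W}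
    (hG : IsVertexTransitive G) (hH : IsVertexTransitive H) :
    IsVertexTransitive (strongProd G H) where
  exists_smul_eq x y := by
    obtain ⟨e₁, h₁⟩ := hG.exists_smul_eq x.1 y.1
    obtain ⟨e₂, h₂⟩ := hH.exists_smul_eq x.2 y.2
    refine ⟨isoOfConfusable (e₁.toEquiv.prodCongr e₂.toEquiv) fun x y => ?_, Prod.ext h₁ h₂⟩
    simp [confusable_strongProd, confusable_iso_iff]

end VertexTransitive

namespace SpectralPoint

variable (f : SpectralPoint.{u}) {V W : Type u} [Finite V] [Finite W]
  {G : SimpleGraph V} {H : SimpleGraph W}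

lemma val_le_of_confusable_imp (φ : V → W)
    (h : ∀ x y, Confusable H (φ x) (φ y) → Confusable G x y) : f.val G ≤ f.val H := by
  refine f.mono G H ⟨φ, fun {x y} hxy => ?_⟩
  simp only [SimpleGraph.compl_adj, ← not_or] at hxy ⊢
  exact mt (h x y) hxy

lemma val_le_of_embedding (φ : G ↪g H) : f.val G ≤ f.val H :=
  f.val_le_of_confusable_imp φ fun _ _ => (confusable_embedding_iff φ).1

lemma val_le_card (G : SimpleGraph V) : f.val G ≤ Nat.card V := by
  rw [← f.edgeless]
  exact f.val_le_of_confusable_imp id fun _ _ h => Or.inl (confusable_bot.1 h)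

lemma one_le_val [Nonempty V] (G : SimpleGraph V) : 1 ≤ f.val G := by
  have h : f.val (⊥ : SimpleGraph PUnit.{u + 1}) ≤ f.val G :=
    f.val_le_of_confusable_imp (fun _ => Classical.arbitrary V) fun _ _ _ => Or.inl rfl
  rwa [f.edgeless, Nat.card_unique, Nat.cast_one] at h

/-- If the translates of `H` by a set `A` of automorphisms cover `G`, then `G` maps into the strong
product of `H` with the edgeless graph on `A`. -/
lemma val_le_of_isVertexTransitive [Nonempty V] (hH : IsVertexTransitive H) (φ : G ↪g H) :
    f.val H ≤ f.val G * (Nat.card W / Nat.card V) * (1 + Real.log (Nat.card W)) := by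
  classical
  have := Fintype.ofFinite V
  have := Fintype.ofFinite W
  have : Finite (H ≃g H) := .of_injective _ RelIso.toEquiv_injective
  have : MulAction.IsPretransitive (H ≃g H) W := hH
  obtain ⟨A, hA, hcard⟩ :=
    exists_smul_eq_univ (Γ := H ≃g H) (univ_nonempty.image φ : (univ.image φ).Nonempty)
  have hcover (w : W) : ∃ a : A × V, a.1.1 (φ a.2) = w := by
    obtain ⟨e, he, _, hv, rfl⟩ := mem_smul.1 (hA ▸ mem_univ w)
    obtain ⟨v, -, rfl⟩ := mem_image.1 hv
    exact ⟨(⟨e, he⟩, v), rfl⟩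
  choose ψ hψ using hcover
  have hval : f.val H ≤ #A * f.val G := by
    have : f.val (strongProd (⊥ : SimpleGraph A) G) = #A * f.val G := by
      simp [f.strong, f.edgeless]
    rw [← this]
    refine f.val_le_of_confusable_imp ψ fun w w' h => ?_
    rw [confusable_strongProd, confusable_bot] at h
    rw [← hψ w, ← hψ w', h.1]
    exact (confusable_iso_iff _).2 ((confusable_embedding_iff φ).2 h.2)
  rw [card_image_of_injective _ φ.injective, card_univ] at hcard
  simp only [Nat.card_eq_fintype_card]
  calc f.val H ≤ #A * f.val G := hval
    _ ≤ (Fintype.card W * (1 + Real.log (Fintype.card W)) / Fintype.card V) * f.val G := by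
      gcongr
      · exact f.nonneg G
      · exact (le_div_iff₀ (by exact_mod_cast Fintype.card_pos)).2 hcard
    _ = _ := by ring

/-- The logarithm to base `2` of the value of a spectral point. -/
def logVal (G : SimpleGraph V) : ℝ :=
  Real.logb 2 (f.val G)

lemma logVal_nonneg [Nonempty V] (G : SimpleGraph V) : 0 ≤ f.logVal G :=
  Real.logb_nonneg one_lt_two (f.one_le_val G)

lemma logVal_le_logb_card [Nonempty V] (G : SimpleGraph V) :
    f.logVal G ≤ Real.logb 2 (Nat.card V) :=
  Real.logb_le_logb_of_le one_lt_two (zero_lt_one.trans_le (f.one_le_val G)) (f.val_le_card G)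

lemma logVal_le_of_embedding [Nonempty V] (φ : G ↪g H) : f.logVal G ≤ f.logVal H :=
  Real.logb_le_logb_of_le one_lt_two (zero_lt_one.trans_le (f.one_le_val G))
    (f.val_le_of_embedding φ)

lemma logVal_strongProd [Nonempty V] [Nonempty W] (G : SimpleGraph V) (H : SimpleGraph W) :
    f.logVal (strongProd G H) = f.logVal G + f.logVal H := by
  rw [logVal, f.strong]
  exact Real.logb_mul (zero_lt_one.trans_le (f.one_le_val G)).ne'
    (zero_lt_one.trans_le (f.one_le_val H)).ne'

lemma logVal_le_of_isVertexTransitive [Nonempty V] (hH : IsVertexTransitive H) (φ : G ↪g H) :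
    f.logVal H ≤ f.logVal G + (Real.logb 2 (Nat.card W) - Real.logb 2 (Nat.card V)) +
      Real.logb 2 (1 + Real.logb 2 (Nat.card W)) := by
  have : Nonempty W := ‹Nonempty V›.map φ
  have hV : (Nat.card V : ℝ) ≠ 0 := by exact_mod_cast Nat.card_pos.ne'
  have hW : (Nat.card W : ℝ) ≠ 0 := by exact_mod_cast Nat.card_pos.ne'
  have hG := (zero_lt_one.trans_le (f.one_le_val G)).ne'
  have hlog : 0 ≤ Real.log (Nat.card W) := Real.log_natCast_nonneg _
  have hlogb : Real.log (Nat.card W) ≤ Real.logb 2 (Nat.card W) :=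
    le_div_self hlog (Real.log_pos one_lt_two) (Real.log_two_lt_d9.le.trans (by norm_num))
  have h := Real.logb_le_logb_of_le one_lt_two (zero_lt_one.trans_le (f.one_le_val H))
    (f.val_le_of_isVertexTransitive hH φ)
  rw [Real.logb_mul (by positivity) (by positivity), Real.logb_mul hG (by positivity),
    Real.logb_div hW hV] at h
  exact h.trans (add_le_add le_rfl (Real.logb_le_logb_of_le one_lt_two (by positivity)
    (add_le_add le_rfl hlogb)))

end SpectralPoint

section Marginals

variable {V₁ V₂ W M : Type*} [AddCommMonoid M]

/-- The first marginal of a weight `s` on `W`, where `φ` reads elements of `W` as pairs. -/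
abbrev fstMarginal [Finite V₁] [Finite W] (φ : W → V₁ × V₂) (s : W → M) : V₁ → M :=
  FunOnFinite.map (fun w => (φ w).1) s

/-- The second marginal of a weight `s` on `W`, where `φ` reads elements of `W` as pairs. -/
abbrev sndMarginal [Finite V₂] [Finite W] (φ : W → V₁ × V₂) (s : W → M) : V₂ → M :=
  FunOnFinite.map (fun w => (φ w).2) s

lemma sum_map_funOnFinite [Fintype V₁] [Fintype W] (π : W → V₁) (s : W → M) :
    ∑ v, FunOnFinite.map π s v = ∑ w, s w := by
  classical
  simp only [FunOnFinite.map_apply_apply]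
  exact sum_fiberwise univ π s

end Marginals

section LetterCount

variable {ι κ V W : Type*}

/-- The number of occurrences of each letter in a string. -/
def letterCount (x : ι → V) (a : V) : ℕ :=
  {i | x i = a}.ncard

lemma letterCount_comp_equiv (x : ι → V) (e : κ ≃ ι) : letterCount (x ∘ e) = letterCount x :=
  funext fun a => Set.ncard_congr (fun i _ => e i) (fun _ h => h)
    (fun _ _ _ _ h => e.injective h) fun i hi => ⟨e.symm i, by simpa using hi, e.apply_symm_apply i⟩

lemma letterCount_eq_sum [Fintype ι] [DecidableEq V] (x : ι → V) (a : V) :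
    letterCount x a = ∑ i, if x i = a then 1 else 0 := by
  rw [letterCount, Set.ncard_eq_toFinset_card', Set.toFinset_ofPred, card_filter]

lemma sum_letterCount [Fintype ι] [Fintype V] (x : ι → V) :
    ∑ a, letterCount x a = Fintype.card ι := by
  classical
  simp only [letterCount_eq_sum]
  rw [sum_comm]
  simp

lemma letterCount_append {m n : ℕ} (x : Fin m → V) (y : Fin n → V) :
    letterCount (Fin.append x y) = letterCount x + letterCount y := by
  classical
  ext a
  simp only [letterCount_eq_sum, Pi.add_apply, Fin.sum_univ_add, Fin.append_left, Fin.append_right]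

lemma letterCount_comp [Finite ι] [Finite V] [Finite W] (π : V → W) (x : ι → V) :
    letterCount (π ∘ x) = FunOnFinite.map π (letterCount x) := by
  classical
  have := Fintype.ofFinite ι
  have := Fintype.ofFinite V
  ext b
  simp only [FunOnFinite.map_apply_apply, letterCount_eq_sum]
  rw [sum_comm]
  simp [sum_ite_eq]

lemma exists_letterCount_eq [Fintype V] (k : V → ℕ) :
    ∃ x : Fin (∑ a, k a) → V, letterCount x = k := by
  let e : (Σ a, Fin (k a)) ≃ Fin (∑ a, k a) := Fintype.equivFinOfCardEq (by simp)
  refine ⟨fun i => (e.symm i).1, (letterCount_comp_equiv Sigma.fst e.symm).trans ?_⟩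
  ext a
  rw [letterCount, ← Nat.card_coe_set_eq]
  exact (Nat.card_congr (Equiv.sigmaSubtype a)).trans (Nat.card_fin _)

lemma exists_perm_comp_eq [Finite ι] {x y : ι → V} (h : letterCount x = letterCount y) :
    ∃ σ : Equiv.Perm ι, x ∘ σ = y := by
  let e (a : V) : {i // y i = a} ≃ {i // x i = a} := (Finite.card_eq.1 (congrFun h.symm a)).some
  refine ⟨(Equiv.sigmaFiberEquiv y).symm.trans
    ((Equiv.sigmaCongrRight e).trans (Equiv.sigmaFiberEquiv x)), funext fun i => ?_⟩
  exact (e (y i) ⟨i, rfl⟩).2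

end LetterCount

section CountClass

variable {V W : Type*}

/-- The strings of length `n` with letter counts `k`: the type classes, parametrized by integers. -/
def countClass (n : ℕ) (k : V → ℕ) : Set (Fin n → V) :=
  {x | letterCount x = k}

lemma countClass_nonempty [Fintype V] {n : ℕ} {k : V → ℕ} (h : ∑ a, k a = n) :
    (countClass n k).Nonempty := by
  subst h
  exact exists_letterCount_eq k

lemma append_mem_countClass {m n : ℕ} {k l : V → ℕ} {x : Fin m → V} {y : Fin n → V}
    (hx : x ∈ countClass m k) (hy : y ∈ countClass n l) :
    Fin.append x y ∈ countClass (m + n) (k + l) :=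
  (letterCount_append x y).trans (congrArg₂ _ hx hy)

lemma comp_mem_countClass [Finite V] [Finite W] (π : V → W) {n : ℕ} {k : V → ℕ} {x : Fin n → V}
    (hx : x ∈ countClass n k) : π ∘ x ∈ countClass n (FunOnFinite.map π k) :=
  (letterCount_comp π x).trans (congrArg _ hx)

lemma orbit_eq_countClass {n : ℕ} {k : V → ℕ} {x : Fin n → V} (hx : x ∈ countClass n k) :
    MulAction.orbit (Equiv.Perm (Fin n))ᵈᵐᵃ x = countClass n k := by
  ext y
  constructor
  · rintro ⟨σ, rfl⟩
    exact (letterCount_comp_equiv x (DomMulAct.mk.symm σ)).trans hx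
  · intro hy
    obtain ⟨σ, hσ⟩ := exists_perm_comp_eq (hx.trans hy.symm)
    exact ⟨DomMulAct.mk σ, hσ⟩

lemma card_stabilizer_domMulAct {ι : Type*} [Finite ι] [Fintype V] (x : ι → V) :
    Nat.card (MulAction.stabilizer (Equiv.Perm ι)ᵈᵐᵃ x) = ∏ a, (letterCount x a).factorial := by
  refine Eq.trans ?_ (DomMulAct.stabilizer_ncard (f := x))
  exact (Nat.card_congr (DomMulAct.mk.subtypeEquiv fun _ => Iff.rfl)).symm

lemma card_countClass [Fintype V] {n : ℕ} {k : V → ℕ} (h : ∑ a, k a = n) :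
    Nat.card (countClass n k) = Nat.multinomial univ k := by
  subst h
  obtain ⟨x, hx⟩ := countClass_nonempty (k := k) rfl
  have horbit := Subgroup.card_mul_index
    (MulAction.stabilizer (Equiv.Perm (Fin (∑ a, k a)))ᵈᵐᵃ x)
  rw [MulAction.index_stabilizer, orbit_eq_countClass hx, card_stabilizer_domMulAct,
    ← Nat.card_coe_set_eq, Nat.card_congr DomMulAct.mk.symm, Nat.card_perm, Nat.card_fin,
    show letterCount x = k from hx, ← Nat.multinomial_spec univ k] at horbit
  exact Nat.eq_of_mul_eq_mul_left (prod_pos fun a _ => Nat.factorial_pos (k a)) horbit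

end CountClass

section CountGraph

variable {V V₁ V₂ W : Type u}

/-- The subgraph of `G^{⊠ n}` induced on the strings with letter counts `k`. -/
abbrev countGraph (G : SimpleGraph V) (n : ℕ) (k : V → ℕ) : SimpleGraph (countClass n k) :=
  (strongPow G n).induce (countClass n k)

lemma confusable_countGraph {G : SimpleGraph V} {n : ℕ} {k : V → ℕ} {x y : countClass n k} :
    Confusable (countGraph G n k) x y ↔ ∀ i, Confusable G (x.1 i) (y.1 i) :=
  confusable_induce.trans confusable_strongPow

lemma isVertexTransitive_countGraph (G : SimpleGraph V) (n : ℕ) (k : V → ℕ) :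
    IsVertexTransitive (countGraph G n k) where
  exists_smul_eq x y := by
    obtain ⟨σ, hσ⟩ := exists_perm_comp_eq (x.2.trans y.2.symm)
    refine ⟨isoOfConfusable ((σ.symm.arrowCongr (Equiv.refl V)).subtypeEquiv fun z => ?_)
      fun z w => ?_, Subtype.ext hσ⟩
    · exact (Eq.congr_left (letterCount_comp_equiv z σ)).symm
    · simp only [confusable_countGraph]
      exact σ.forall_congr_right (q := fun i => Confusable G (z.1 i) (w.1 i))

/-- Concatenation of strings. -/
def countGraphAppend (G : SimpleGraph V) (m n : ℕ) (k l : V → ℕ) :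
    strongProd (countGraph G m k) (countGraph G n l) ↪g countGraph G (m + n) (k + l) :=
  embeddingOfConfusable (fun x => ⟨Fin.append x.1.1 x.2.1, append_mem_countClass x.1.2 x.2.2⟩)
    (fun x y h => by
      have happend := (Fin.appendEquiv m n).injective (a₁ := (x.1.1, x.2.1)) (a₂ := (y.1.1, y.2.1))
        (congrArg Subtype.val h)
      simpa [Prod.ext_iff, Subtype.ext_iff] using happend)
    fun x y => by simp [confusable_countGraph, confusable_strongProd, Fin.forall_fin_add]

/-- A string over a subgraph of `G₁ ⊠ G₂` is a pair of strings whose letter counts are the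
marginals. -/
def countGraphUnzip {K : SimpleGraph W} {G₁ : SimpleGraph V₁} {G₂ : SimpleGraph V₂} [Finite W]
    [Finite V₁] [Finite V₂] (φ : K ↪g strongProd G₁ G₂) (n : ℕ) (k : W → ℕ) :
    countGraph K n k ↪g
      strongProd (countGraph G₁ n (fstMarginal φ k)) (countGraph G₂ n (sndMarginal φ k)) :=
  embeddingOfConfusable
    (fun x => (⟨fun i => (φ (x.1 i)).1, comp_mem_countClass _ x.2⟩,
      ⟨fun i => (φ (x.1 i)).2, comp_mem_countClass _ x.2⟩))
    (fun x y h => by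
      simp only [Prod.ext_iff, Subtype.ext_iff, funext_iff] at h
      exact Subtype.ext (funext fun i => φ.injective (Prod.ext (h.1 i) (h.2 i))))
    fun x y => by
      simp only [confusable_countGraph, confusable_strongProd, ← forall_and,
        ← confusable_embedding_iff φ]

end CountGraph

section LogCountVal

variable {V V₁ V₂ W : Type u} [Fintype V] [Fintype V₁] [Fintype V₂] [Fintype W]

/-- The logarithm to base `2` of the number of strings with letter counts `k`. -/
def logMultinomial {V : Type*} [Fintype V] (k : V → ℕ) : ℝ :=
  Real.logb 2 (Nat.multinomial univ k)

lemma logb_card_countClass {V : Type*} [Fintype V] {n : ℕ} {k : V → ℕ} (h : ∑ a, k a = n) :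
    Real.logb 2 (Nat.card (countClass n k)) = logMultinomial k := by
  rw [card_countClass h, logMultinomial]

lemma logb_card_prod {X Y : Type*} [Finite X] [Finite Y] [Nonempty X] [Nonempty Y] :
    Real.logb 2 (Nat.card (X × Y)) = Real.logb 2 (Nat.card X) + Real.logb 2 (Nat.card Y) := by
  rw [Nat.card_prod, Nat.cast_mul, Real.logb_mul] <;> exact_mod_cast Nat.card_pos.ne'

/-- The logarithm to base `2` of the value of a spectral point at the graph of all strings with
letter counts `k`, whose length is forced to be `∑ a, k a`. -/
def logCountVal (f : SpectralPoint.{u}) (G : SimpleGraph V) (k : V → ℕ) : ℝ :=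
  f.logVal (countGraph G (∑ a, k a) k)

variable (f : SpectralPoint.{u}) (G : SimpleGraph V) {K : SimpleGraph W} {G₁ : SimpleGraph V₁}
  {G₂ : SimpleGraph V₂}

lemma logVal_countGraph {n : ℕ} {k : V → ℕ} (h : ∑ a, k a = n) :
    f.logVal (countGraph G n k) = logCountVal f G k := by
  subst h
  rfl

lemma logCountVal_nonneg (k : V → ℕ) : 0 ≤ logCountVal f G k :=
  have := (countClass_nonempty (k := k) rfl).to_subtype
  f.logVal_nonneg _

lemma logCountVal_le_logMultinomial (k : V → ℕ) : logCountVal f G k ≤ logMultinomial k := by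
  have := (countClass_nonempty (k := k) rfl).to_subtype
  rw [← logb_card_countClass rfl]
  exact f.logVal_le_logb_card _

lemma logCountVal_add_le (k l : V → ℕ) :
    logCountVal f G k + logCountVal f G l ≤ logCountVal f G (k + l) := by
  have := (countClass_nonempty (k := k) rfl).to_subtype
  have := (countClass_nonempty (k := l) rfl).to_subtype
  rw [← logVal_countGraph f G (k := k + l) sum_add_distrib, logCountVal, logCountVal,
    ← f.logVal_strongProd]
  exact f.logVal_le_of_embedding (countGraphAppend G _ _ k l)

lemma logCountVal_mono : Monotone (logCountVal f G) := fun k l h => by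
  obtain ⟨l, rfl⟩ := exists_add_of_le h
  linarith [logCountVal_add_le f G k l, logCountVal_nonneg f G l]

lemma logCountVal_add_le_add_logMultinomial (k l : V → ℕ) :
    logCountVal f G (k + l) ≤ logCountVal f G k + (logMultinomial (k + l) - logMultinomial k) +
      Real.logb 2 (1 + logMultinomial (k + l)) := by
  have := (countClass_nonempty (k := k) rfl).to_subtype
  have := (countClass_nonempty (k := l) rfl).to_subtype
  have hcover := f.logVal_le_of_isVertexTransitive
    (isVertexTransitive_countGraph G _ (k + l)) (countGraphAppend G (∑ a, k a) (∑ a, l a) k l)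
  have hsum : ∑ a, (k + l) a = ∑ a, k a + ∑ a, l a := sum_add_distrib
  rw [logVal_countGraph f G hsum, f.logVal_strongProd, logb_card_prod,
    logb_card_countClass hsum, logb_card_countClass rfl, logb_card_countClass rfl,
    logVal_countGraph f G rfl, logVal_countGraph f G rfl] at hcover
  linarith [logCountVal_le_logMultinomial f G l]

lemma logCountVal_le_add_marginals (φ : K ↪g strongProd G₁ G₂) (k : W → ℕ) :
    logCountVal f K k ≤
      logCountVal f G₁ (fstMarginal φ k) + logCountVal f G₂ (sndMarginal φ k) := by
  have h₁ := sum_map_funOnFinite (fun w => (φ w).1) k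
  have h₂ := sum_map_funOnFinite (fun w => (φ w).2) k
  have := (countClass_nonempty (k := k) rfl).to_subtype
  have := (countClass_nonempty h₁).to_subtype
  have := (countClass_nonempty h₂).to_subtype
  rw [← logVal_countGraph f G₁ h₁, ← logVal_countGraph f G₂ h₂, ← f.logVal_strongProd]
  exact f.logVal_le_of_embedding (countGraphUnzip φ _ k)

lemma add_marginals_le_logCountVal (φ : K ↪g strongProd G₁ G₂) (k : W → ℕ) :
    logCountVal f G₁ (fstMarginal φ k) + logCountVal f G₂ (sndMarginal φ k) ≤
      logCountVal f K k +
        (logMultinomial (fstMarginal φ k) + logMultinomial (sndMarginal φ k) - logMultinomial k) +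
        Real.logb 2
          (1 + (logMultinomial (fstMarginal φ k) + logMultinomial (sndMarginal φ k))) := by
  have h₁ := sum_map_funOnFinite (fun w => (φ w).1) k
  have h₂ := sum_map_funOnFinite (fun w => (φ w).2) k
  have := (countClass_nonempty (k := k) rfl).to_subtype
  have := (countClass_nonempty h₁).to_subtype
  have := (countClass_nonempty h₂).to_subtype
  have hcover := f.logVal_le_of_isVertexTransitive
    ((isVertexTransitive_countGraph G₁ _ _).strongProd (isVertexTransitive_countGraph G₂ _ _))
    (countGraphUnzip φ (∑ w, k w) k)
  rwa [f.logVal_strongProd, logb_card_prod, logb_card_countClass rfl, logb_card_countClass h₁,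
    logb_card_countClass h₂, logVal_countGraph f K rfl, logVal_countGraph f G₁ h₁,
    logVal_countGraph f G₂ h₂] at hcover

end LogCountVal

section Asymptotics

lemma tendsto_log_one_add_div {s : ℕ → ℝ} (hs : ∀ n, 0 ≤ s n) {c : ℝ}
    (h : Tendsto (fun n : ℕ => s n / n) atTop (𝓝 c)) :
    Tendsto (fun n : ℕ => Real.log (1 + s n) / n) atTop (𝓝 0) := by
  have hsqrt : Tendsto (fun n : ℕ => 2 * √((1 / n + s n / n) * (1 / n))) atTop (𝓝 0) := by
    simpa using ((((tendsto_one_div_atTop_nhds_zero_nat (𝕜 := ℝ)).add h).mul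
      tendsto_one_div_atTop_nhds_zero_nat).sqrt).const_mul 2
  refine squeeze_zero (fun n => div_nonneg (Real.log_nonneg (by linarith [hs n])) n.cast_nonneg)
    (fun n => ?_) hsqrt
  have hlog : Real.log (1 + s n) ≤ 2 * √(1 + s n) := by
    have := Real.log_le_self (Real.sqrt_nonneg (1 + s n))
    rw [Real.log_sqrt (by linarith [hs n])] at this
    linarith
  calc Real.log (1 + s n) / n ≤ 2 * √(1 + s n) / n := by gcongr
    _ = 2 * √((1 / n + s n / n) * (1 / n)) := by
      rw [← add_div, div_mul_div_comm, mul_one, Real.sqrt_div' _ (by positivity),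
        Real.sqrt_mul_self n.cast_nonneg, mul_div_assoc]

lemma mul_log_sub_le_log_factorial (n : ℕ) : n * Real.log n - n ≤ Real.log n.factorial := by
  rcases eq_or_ne n 0 with rfl | hn
  · simp
  have hpi : 0 ≤ Real.log (2 * Real.pi) := Real.log_nonneg (by linarith [Real.two_le_pi])
  linarith [Stirling.le_log_factorial_stirling hn, Real.log_natCast_nonneg n]

lemma log_factorial_le (n : ℕ) :
    Real.log n.factorial ≤ n * Real.log n - n + (1 + Real.log (1 + n)) := by
  rcases n with _ | n
  · simp
  have h : Real.log (Stirling.stirlingSeq (n + 1)) ≤ Real.log (Stirling.stirlingSeq 1) :=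
    Real.log_le_log (Stirling.stirlingSeq'_pos n) (Stirling.stirlingSeq'_antitone n.zero_le)
  rw [Stirling.log_stirlingSeq_formula, Stirling.log_stirlingSeq_formula,
    Real.log_mul two_ne_zero (by positivity),
    Real.log_div (by positivity) (Real.exp_pos 1).ne', Real.log_exp] at h
  have hlog : Real.log (n + 1 : ℕ) ≤ Real.log (1 + (n + 1 : ℕ)) :=
    Real.log_le_log (by positivity) (by linarith)
  norm_num at h
  have hnonneg := Real.log_natCast_nonneg (n + 1)
  push_cast at hlog hnonneg ⊢
  linarith

/-- The letter counts `k n` have relative frequencies `k n / n` converging to `P`. -/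
def HasFrequencies {V : Type*} (k : ℕ → V → ℕ) (P : V → ℝ) : Prop :=
  ∀ a, Tendsto (fun n : ℕ => (k n a : ℝ) / n) atTop (𝓝 (P a))

variable {V W : Type*} {k l : ℕ → V → ℕ} {P : V → ℝ}

lemma HasFrequencies.inf (hk : HasFrequencies k P) (hl : HasFrequencies l P) :
    HasFrequencies (fun n => k n ⊓ l n) P := fun a => by
  have h := (hk a).min (hl a)
  rw [min_self] at h
  refine h.congr fun n => ?_
  simp only [Pi.inf_apply, Nat.cast_min, min_div_div_right n.cast_nonneg]

lemma HasFrequencies.map [Finite V] [Finite W] (hk : HasFrequencies k P) (π : V → W) :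
    HasFrequencies (fun n => FunOnFinite.map π (k n)) (FunOnFinite.map π P) := fun b => by
  classical
  have := Fintype.ofFinite V
  simpa [FunOnFinite.map_apply_apply, sum_div] using tendsto_finsetSum _ fun a _ => hk a

/-- Letter counts with frequencies converging to `P` from below. -/
def floorCount (P : V → ℝ) (n : ℕ) (a : V) : ℕ :=
  ⌊P a * n⌋₊

lemma hasFrequencies_floorCount (hP : 0 ≤ P) : HasFrequencies (floorCount P) P := fun a =>
  (tendsto_nat_floor_mul_div_atTop (hP a)).comp tendsto_natCast_atTop_atTop

lemma floorCount_add_le (hP : 0 ≤ P) (m n : ℕ) :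
    floorCount P m + floorCount P n ≤ floorCount P (m + n) := fun a => by
  refine Nat.le_floor ?_
  rw [Pi.add_apply, Nat.cast_add, Nat.cast_add, mul_add]
  exact add_le_add (Nat.floor_le (mul_nonneg (hP a) m.cast_nonneg))
    (Nat.floor_le (mul_nonneg (hP a) n.cast_nonneg))

lemma sum_floorCount_le [Fintype V] (hP : P ∈ stdSimplex ℝ V) (n : ℕ) :
    ∑ a, floorCount P n a ≤ n := by
  rw [← Nat.cast_le (α := ℝ), Nat.cast_sum]
  calc ∑ a, (floorCount P n a : ℝ) ≤ ∑ a, P a * n :=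
        sum_le_sum fun a _ => Nat.floor_le (mul_nonneg (hP.1 a) n.cast_nonneg)
    _ = n := by rw [← sum_mul, hP.2, one_mul]

lemma tendsto_log_factorial {k : ℕ → ℕ} {p : ℝ}
    (hk : Tendsto (fun n : ℕ => (k n : ℝ) / n) atTop (𝓝 p)) :
    Tendsto (fun n : ℕ => (Real.log (k n).factorial - k n * Real.log n + k n) / n) atTop
      (𝓝 (p * Real.log p)) := by
  have hmain : Tendsto (fun n : ℕ => (k n : ℝ) / n * Real.log (k n / n)) atTop
      (𝓝 (p * Real.log p)) := Real.continuous_mul_log.continuousAt.tendsto.comp hk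
  have herror := hmain.add ((tendsto_one_div_atTop_nhds_zero_nat (𝕜 := ℝ)).add
    (tendsto_log_one_add_div (fun n => (k n).cast_nonneg) hk))
  rw [add_zero, add_zero] at herror
  have hmul_log (n : ℕ) (hn : 0 < n) : (k n : ℝ) / n * Real.log (k n / n) =
      (k n * Real.log (k n) - k n * Real.log n) / n := by
    rcases eq_or_ne (k n) 0 with h0 | h0
    · simp [h0]
    · rw [Real.log_div (by exact_mod_cast h0) (by exact_mod_cast hn.ne')]
      ring
  refine tendsto_of_tendsto_of_tendsto_of_le_of_le' hmain herror ?_ ?_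
  · filter_upwards [eventually_gt_atTop 0] with n hn
    rw [hmul_log n hn]
    refine div_le_div_of_nonneg_right ?_ n.cast_nonneg
    linarith [mul_log_sub_le_log_factorial (k n)]
  · filter_upwards [eventually_gt_atTop 0] with n hn
    rw [hmul_log n hn, ← add_div, ← add_div]
    refine div_le_div_of_nonneg_right ?_ n.cast_nonneg
    linarith [log_factorial_le (k n)]

lemma logMultinomial_eq [Fintype V] (k : V → ℕ) :
    logMultinomial k =
      (Real.log (∑ a, k a).factorial - ∑ a, Real.log (k a).factorial) / Real.log 2 := by
  rw [logMultinomial, Real.logb]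
  congr 1
  have hspec := congrArg (fun m : ℕ => Real.log m) (Nat.multinomial_spec univ k)
  simp only [Nat.cast_mul, Nat.cast_prod] at hspec
  rw [Real.log_mul (by positivity) (by exact_mod_cast (Nat.multinomial_pos _ _).ne'),
    Real.log_prod fun a _ => by positivity] at hspec
  linarith

lemma logMultinomial_nonneg [Fintype V] (k : V → ℕ) : 0 ≤ logMultinomial k :=
  Real.logb_nonneg one_lt_two (by exact_mod_cast Nat.multinomial_pos _ _)

lemma tendsto_logMultinomial_div [Fintype V] (hk : HasFrequencies k P) :
    Tendsto (fun n : ℕ => logMultinomial (k n) / n) atTop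
      (𝓝 (entropy P + (∑ a, P a) * Real.logb 2 (∑ a, P a))) := by
  have hsum : Tendsto (fun n : ℕ => ((∑ a, k n a : ℕ) : ℝ) / n) atTop (𝓝 (∑ a, P a)) := by
    simpa [sum_div] using tendsto_finsetSum univ fun a _ => hk a
  have h := ((tendsto_log_factorial hsum).sub
    (tendsto_finsetSum univ fun a _ => tendsto_log_factorial (hk a))).div_const (Real.log 2)
  have hlim : ((∑ a, P a) * Real.log (∑ a, P a) - ∑ a, P a * Real.log (P a)) / Real.log 2 =
      entropy P + (∑ a, P a) * Real.logb 2 (∑ a, P a) := by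
    simp only [entropy, Real.logb, sum_neg_distrib, sub_div, sum_div, mul_div_assoc]
    ring
  rw [hlim] at h
  refine h.congr fun n => ?_
  rw [logMultinomial_eq, ← sum_div, sum_add_distrib, sum_sub_distrib, ← sum_mul, Nat.cast_sum]
  ring

lemma tendsto_logb_one_add_div {s : ℕ → ℝ} (hs : ∀ n, 0 ≤ s n) {c : ℝ}
    (h : Tendsto (fun n : ℕ => s n / n) atTop (𝓝 c)) :
    Tendsto (fun n : ℕ => Real.logb 2 (1 + s n) / n) atTop (𝓝 0) := by
  have := (tendsto_log_one_add_div hs h).div_const (Real.log 2)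
  rw [zero_div] at this
  exact this.congr fun n => div_right_comm _ _ _

end Asymptotics

section CountRate

variable {V V₁ V₂ W : Type u} [Fintype V] [Fintype V₁] [Fintype V₂] [Fintype W]
  (f : SpectralPoint.{u}) (G : SimpleGraph V) {K : SimpleGraph W} {G₁ : SimpleGraph V₁}
  {G₂ : SimpleGraph V₂} {P : V → ℝ}

/-- `L` is the exponential growth rate of `f` at the graphs of all strings with prescribed letter
counts, along any letter counts with frequencies converging to `P`. Unlike in `IsProbRefinement`,
the strings indexed by `n` need not have length `n`. -/
def IsCountRate (P : V → ℝ) (L : ℝ) : Prop :=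
  ∀ k, HasFrequencies k P → Tendsto (fun n : ℕ => logCountVal f G (k n) / n) atTop (𝓝 L)

lemma tendsto_logCountVal_sub_of_le {k l : ℕ → V → ℕ} (hkl : k ≤ l) (hk : HasFrequencies k P)
    (hl : HasFrequencies l P) :
    Tendsto (fun n : ℕ => logCountVal f G (l n) / n - logCountVal f G (k n) / n) atTop (𝓝 0) := by
  have hbound := ((tendsto_logMultinomial_div hl).sub (tendsto_logMultinomial_div hk)).add
    (tendsto_logb_one_add_div (fun n => logMultinomial_nonneg (l n))
      (tendsto_logMultinomial_div hl))
  rw [sub_self, zero_add] at hbound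
  refine squeeze_zero (fun n => ?_) (fun n => ?_) hbound
  · rw [← sub_div]
    exact div_nonneg (sub_nonneg.2 (logCountVal_mono f G (hkl n))) n.cast_nonneg
  · rw [← sub_div, ← sub_div, ← add_div]
    refine div_le_div_of_nonneg_right ?_ n.cast_nonneg
    have h := logCountVal_add_le_add_logMultinomial f G (k n) (l n - k n)
    rw [add_tsub_cancel_of_le (hkl n)] at h
    linarith

lemma tendsto_logCountVal_sub {k l : ℕ → V → ℕ} (hk : HasFrequencies k P)
    (hl : HasFrequencies l P) :
    Tendsto (fun n : ℕ => logCountVal f G (l n) / n - logCountVal f G (k n) / n) atTop (𝓝 0) := by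
  have hleft := tendsto_logCountVal_sub_of_le f G (fun _ => inf_le_left) (hk.inf hl) hk
  have hright := tendsto_logCountVal_sub_of_le f G (fun _ => inf_le_right) (hk.inf hl) hl
  simpa using hright.sub hleft

lemma exists_tendsto_logCountVal_floorCount (hP : 0 ≤ P) :
    ∃ L, Tendsto (fun n : ℕ => logCountVal f G (floorCount P n) / n) atTop (𝓝 L) := by
  have hsub : Subadditive fun n => -logCountVal f G (floorCount P n) := fun m n => by
    linarith [logCountVal_mono f G (floorCount_add_le hP m n),
      logCountVal_add_le f G (floorCount P m) (floorCount P n)]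
  have hbdd : BddBelow (Set.range fun n : ℕ => -logCountVal f G (floorCount P n) / n) := by
    obtain ⟨B, hB⟩ := (tendsto_logMultinomial_div (hasFrequencies_floorCount hP)).bddAbove_range
    refine ⟨-B, Set.forall_mem_range.2 fun n => ?_⟩
    rw [neg_div, neg_le_neg_iff]
    exact (div_le_div_of_nonneg_right (logCountVal_le_logMultinomial f G _) n.cast_nonneg).trans
      (hB ⟨n, rfl⟩)
  exact ⟨-hsub.lim, (hsub.tendsto_lim hbdd).neg.congr fun n => by rw [neg_div, neg_neg]⟩

lemma exists_isCountRate (hP : 0 ≤ P) : ∃ L, IsCountRate f G P L := by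
  obtain ⟨L, hL⟩ := exists_tendsto_logCountVal_floorCount f G hP
  refine ⟨L, fun k hk => ?_⟩
  simpa using hL.add (tendsto_logCountVal_sub f G (hasFrequencies_floorCount hP) hk)

variable {f G}

lemma IsCountRate.nonneg (hP : 0 ≤ P) {L : ℝ} (hL : IsCountRate f G P L) : 0 ≤ L :=
  ge_of_tendsto' (hL _ (hasFrequencies_floorCount hP)) fun n =>
    div_nonneg (logCountVal_nonneg f G _) n.cast_nonneg

lemma tendsto_logMultinomial_div_entropy (hP : ∑ a, P a = 1) {k : ℕ → V → ℕ}
    (hk : HasFrequencies k P) :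
    Tendsto (fun n : ℕ => logMultinomial (k n) / n) atTop (𝓝 (entropy P)) := by
  simpa [hP] using tendsto_logMultinomial_div hk

lemma IsCountRate.le_entropy (hP : P ∈ stdSimplex ℝ V) {L : ℝ} (hL : IsCountRate f G P L) :
    L ≤ entropy P :=
  have hk := hasFrequencies_floorCount hP.1
  le_of_tendsto_of_tendsto' (hL _ hk) (tendsto_logMultinomial_div_entropy hP.2 hk) fun n =>
    div_le_div_of_nonneg_right (logCountVal_le_logMultinomial f G _) n.cast_nonneg

lemma IsCountRate.le_add_marginals {P : W → ℝ} (hP : 0 ≤ P) {L L₁ L₂ : ℝ}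
    (hL : IsCountRate f K P L) (φ : K ↪g strongProd G₁ G₂)
    (hL₁ : IsCountRate f G₁ (fstMarginal φ P) L₁) (hL₂ : IsCountRate f G₂ (sndMarginal φ P) L₂) :
    L ≤ L₁ + L₂ := by
  have hk := hasFrequencies_floorCount hP
  refine le_of_tendsto_of_tendsto' (hL _ hk) ((hL₁ _ (hk.map _)).add (hL₂ _ (hk.map _)))
    fun n => ?_
  rw [← add_div]
  exact div_le_div_of_nonneg_right (logCountVal_le_add_marginals f φ _) n.cast_nonneg

lemma IsCountRate.add_marginals_le {P : W → ℝ} (hP : P ∈ stdSimplex ℝ W) {L L₁ L₂ : ℝ}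
    (hL : IsCountRate f K P L) (φ : K ↪g strongProd G₁ G₂)
    (hL₁ : IsCountRate f G₁ (fstMarginal φ P) L₁) (hL₂ : IsCountRate f G₂ (sndMarginal φ P) L₂) :
    L₁ + L₂ ≤ L + (entropy (fstMarginal φ P) + entropy (sndMarginal φ P) - entropy P) := by
  have hk := hasFrequencies_floorCount hP.1
  have hk₁ := hk.map fun w => (φ w).1
  have hk₂ := hk.map fun w => (φ w).2
  have hentropy := tendsto_logMultinomial_div_entropy hP.2 hk
  have hmarginals :=
    (tendsto_logMultinomial_div_entropy ((sum_map_funOnFinite _ _).trans hP.2) hk₁).add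
      (tendsto_logMultinomial_div_entropy ((sum_map_funOnFinite _ _).trans hP.2) hk₂)
  simp only [← add_div] at hmarginals
  have herror := tendsto_logb_one_add_div
    (fun n => add_nonneg (logMultinomial_nonneg _) (logMultinomial_nonneg _)) hmarginals
  have hright := ((hL _ hk).add (hmarginals.sub hentropy)).add herror
  rw [add_zero] at hright
  refine le_of_tendsto_of_tendsto' ((hL₁ _ hk₁).add (hL₂ _ hk₂)) hright fun n => ?_
  simp only [← add_div, ← sub_div]
  exact div_le_div_of_nonneg_right (add_marginals_le_logCountVal f φ _) n.cast_nonneg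

end CountRate

section ProbRefinement

variable {V : Type u} {P Q : V → ℝ}

lemma typeClass_stringType {n : ℕ} (hn : n ≠ 0) (x : Fin n → V) :
    typeClass n (stringType x) = countClass n (letterCount x) := by
  ext y
  have hn : (n : ℝ) ≠ 0 := Nat.cast_ne_zero.2 hn
  change (fun a => (letterCount y a : ℝ) / n) = (fun a => (letterCount x a : ℝ) / n) ↔
    letterCount y = letterCount x
  simp only [funext_iff, div_left_inj' hn, Nat.cast_inj]

variable [Fintype V] {f : SpectralPoint.{u}} {G : SimpleGraph V}

lemma logb_val_typeClass_stringType {n : ℕ} (hn : n ≠ 0) (x : Fin n → V) :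
    Real.logb 2 (f.val ((strongPow G n).induce (typeClass n (stringType x)))) =
      logCountVal f G (letterCount x) := by
  rw [typeClass_stringType hn]
  exact logVal_countGraph f G ((sum_letterCount x).trans (Fintype.card_fin n))

lemma IsCountRate.isProbRefinement {L : ℝ} (h : IsCountRate f G P L) :
    IsProbRefinement f G P L := by
  intro Q hQ hQP
  rw [tendsto_pi_nhds] at hQP
  choose! k hk hval using fun n (hn : 0 < n) =>
    show ∃ k : V → ℕ, (∀ a, k a / n = Q n a) ∧ logCountVal f G k =
        Real.logb 2 (f.val ((strongPow G n).induce (typeClass n (Q n)))) by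
      obtain ⟨x, hx⟩ := hQ n hn
      rw [← hx]
      exact ⟨letterCount x, fun _ => rfl, (logb_val_typeClass_stringType hn.ne' x).symm⟩
  refine (h k fun a => (hQP a).congr' ?_).congr' ?_ <;>
    filter_upwards [eventually_gt_atTop 0] with n hn
  · exact (hk n hn a).symm
  · rw [hval n hn]

lemma exists_tendsto_isNType (hP : P ∈ stdSimplex ℝ V) :
    ∃ Q : ℕ → V → ℝ, (∀ n, 0 < n → IsNType n (Q n)) ∧ Tendsto Q atTop (𝓝 P) := by
  classical
  obtain ⟨a₀⟩ : Nonempty V := by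
    by_contra! hV
    simpa using hP.2
  have hfreq := hasFrequencies_floorCount hP.1
  let d (n : ℕ) : ℕ := n - ∑ a, floorCount P n a
  have hd : Tendsto (fun n : ℕ => (d n : ℝ) / n) atTop (𝓝 0) := by
    have h := (tendsto_finsetSum univ fun a _ => hfreq a).const_sub 1
    rw [hP.2, sub_self] at h
    refine h.congr' ?_
    filter_upwards [eventually_ne_atTop 0] with n hn
    rw [Nat.cast_sub (sum_floorCount_le hP n), sub_div, div_self (Nat.cast_ne_zero.2 hn),
      Nat.cast_sum, sum_div]
  have hnonempty (n : ℕ) : (countClass n (floorCount P n + Pi.single a₀ (d n))).Nonempty :=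
    countClass_nonempty <| by
      simp only [Pi.add_apply, sum_add_distrib, sum_pi_single', mem_univ, if_true]
      exact add_tsub_cancel_of_le (sum_floorCount_le hP n)
  choose x hx using hnonempty
  refine ⟨fun n => stringType (x n), fun n _ => ⟨x n, rfl⟩, tendsto_pi_nhds.2 fun a => ?_⟩
  change Tendsto (fun n => (letterCount (x n) a : ℝ) / n) atTop _
  simp only [show ∀ n, letterCount (x n) = _ from hx, Pi.add_apply, Nat.cast_add, add_div]
  obtain rfl | ha := eq_or_ne a a₀
  · simpa using (hfreq a).add hd
  · simpa [Pi.single_eq_of_ne ha] using hfreq a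

lemma isCountRate_probRefinement (f : SpectralPoint.{u}) (G : SimpleGraph V)
    (hP : P ∈ stdSimplex ℝ V) : IsCountRate f G P (probRefinement f G P) := by
  obtain ⟨L, hL⟩ := exists_isCountRate f G hP.1
  obtain ⟨Q, hQ, hQP⟩ := exists_tendsto_isNType hP
  have hspec : IsProbRefinement f G P (probRefinement f G P) :=
    Classical.epsilon_spec ⟨L, hL.isProbRefinement⟩
  rwa [tendsto_nhds_unique (hspec Q hQ hQP) (hL.isProbRefinement Q hQ hQP)]

end ProbRefinement

section Blocks

/-- The block of `n` letters of an infinite word starting at position `m`, counted from `0`. -/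
def block {V : Type*} (m n : ℕ) (ω : ℕ → V) : Fin n → V :=
  fun i => ω (m + i)

lemma measurable_block {V : Type*} [MeasurableSpace V] (m n : ℕ) :
    Measurable (block m n : (ℕ → V) → Fin n → V) :=
  measurable_pi_lambda _ fun _ => measurable_pi_apply _

variable {V : Type u} [MeasurableSpace V] (μ : Measure (ℕ → V))

lemma blockMarginal_apply (m n : ℕ) (x : Fin n → V) :
    blockMarginal μ m n x = μ.real (block m n ⁻¹' {x}) := by
  refine congrArg μ.real (Set.ext fun ω => ?_)
  simp [block, funext_iff]

variable [MeasurableSingletonClass V]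

lemma sum_blockMarginal [IsFiniteMeasure μ] (m n : ℕ) (s : Finset (Fin n → V)) :
    ∑ x ∈ s, blockMarginal μ m n x = μ.real (block m n ⁻¹' s) := by
  simp only [blockMarginal_apply]
  exact sum_measureReal_preimage_singleton s fun x _ =>
    measurable_block m n (measurableSet_singleton x)

lemma blockMarginal_mem_stdSimplex [Fintype V] [IsProbabilityMeasure μ] (m n : ℕ) :
    blockMarginal μ m n ∈ stdSimplex ℝ (Fin n → V) :=
  ⟨fun _ => measureReal_nonneg, by simp [sum_blockMarginal]⟩

section Map

variable [Finite V] [IsFiniteMeasure μ]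

lemma map_blockMarginal {n n' : ℕ} (m m' : ℕ) (π : (Fin n → V) → Fin n' → V)
    (hπ : ∀ ω, π (block m n ω) = block m' n' ω) :
    FunOnFinite.map π (blockMarginal μ m n) = blockMarginal μ m' n' := by
  classical
  have := Fintype.ofFinite V
  ext y
  rw [FunOnFinite.map_apply_apply, sum_blockMarginal, blockMarginal_apply]
  refine congrArg μ.real (Set.ext fun ω => ?_)
  simp [hπ]

lemma fstMarginal_blockMarginal (G : SimpleGraph V) (m n : ℕ) :
    fstMarginal (strongPowAddIso G m n) (blockMarginal μ 0 (m + n)) = blockMarginal μ 0 m :=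
  map_blockMarginal μ 0 0 _ fun _ => rfl

lemma sndMarginal_blockMarginal (G : SimpleGraph V) (m n : ℕ) :
    sndMarginal (strongPowAddIso G m n) (blockMarginal μ 0 (m + n)) = blockMarginal μ m n :=
  map_blockMarginal μ 0 m _ fun ω => by
    ext i
    simp [strongPowAddIso, isoOfConfusable, block]

end Map

variable [IsProbabilityMeasure μ] (f : SpectralPoint.{u}) (G : SimpleGraph V)

lemma isCountRate_blockF [Fintype V] (n : ℕ) :
    IsCountRate f (strongPow G n) (blockMarginal μ 0 n) (blockF f G μ n) :=
  isCountRate_probRefinement f _ (blockMarginal_mem_stdSimplex μ 0 n)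

lemma blockF_nonneg [Finite V] (n : ℕ) : 0 ≤ blockF f G μ n :=
  have := Fintype.ofFinite V
  (isCountRate_blockF μ f G n).nonneg (blockMarginal_mem_stdSimplex μ 0 n).1

lemma blockF_le_blockEntropy [Fintype V] (n : ℕ) : blockF f G μ n ≤ blockEntropy μ n :=
  (isCountRate_blockF μ f G n).le_entropy (blockMarginal_mem_stdSimplex μ 0 n)

variable {μ}

lemma isCountRate_fstMarginal_blockMarginal [Fintype V] (m n : ℕ) :
    IsCountRate f (strongPow G m)
      (fstMarginal (strongPowAddIso G m n) (blockMarginal μ 0 (m + n))) (blockF f G μ m) := by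
  rw [fstMarginal_blockMarginal]
  exact isCountRate_blockF μ f G m

lemma isCountRate_sndMarginal_blockMarginal [Fintype V] (hμ : IsStationary μ) (m n : ℕ) :
    IsCountRate f (strongPow G n)
      (sndMarginal (strongPowAddIso G m n) (blockMarginal μ 0 (m + n))) (blockF f G μ n) := by
  rw [sndMarginal_blockMarginal, hμ m n]
  exact isCountRate_blockF μ f G n

lemma subadditive_blockF [Finite V] (hμ : IsStationary μ) : Subadditive (blockF f G μ) := fun m n =>
  have := Fintype.ofFinite V
  (isCountRate_blockF μ f G (m + n)).le_add_marginals (blockMarginal_mem_stdSimplex μ 0 _).1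
    (strongPowAddIso G m n).toEmbedding (isCountRate_fstMarginal_blockMarginal f G m n)
    (isCountRate_sndMarginal_blockMarginal f G hμ m n)

lemma subadditive_blockEntropy_sub_blockF [Fintype V] (hμ : IsStationary μ) :
    Subadditive fun n => blockEntropy μ n - blockF f G μ n := fun m n => by
  have h := (isCountRate_blockF μ f G (m + n)).add_marginals_le
    (blockMarginal_mem_stdSimplex μ 0 _) (strongPowAddIso G m n).toEmbedding
    (isCountRate_fstMarginal_blockMarginal f G m n)
    (isCountRate_sndMarginal_blockMarginal f G hμ m n)
  have hfst : entropy (fstMarginal (strongPowAddIso G m n).toEmbedding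
      (blockMarginal μ 0 (m + n))) = blockEntropy μ m :=
    congrArg entropy (fstMarginal_blockMarginal μ G m n)
  have hsnd : entropy (sndMarginal (strongPowAddIso G m n).toEmbedding
      (blockMarginal μ 0 (m + n))) = blockEntropy μ n :=
    congrArg entropy ((sndMarginal_blockMarginal μ G m n).trans (hμ m n))
  rw [hfst, hsnd] at h
  simp only [blockEntropy] at h ⊢
  linarith

end Blocks

section Fekete

lemma exists_tendsto_isGLB_of_subadditive {s : ℕ → ℝ} (hs : Subadditive s) (h0 : 0 ≤ s) :
    ∃ L, Tendsto (fun n => s n / n) atTop (𝓝 L) ∧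
      IsGLB ((fun n : ℕ => s n / n) '' Set.Ici 1) L := by
  have hbdd : BddBelow (Set.range fun n : ℕ => s n / n) :=
    ⟨0, Set.forall_mem_range.2 fun n => div_nonneg (h0 n) n.cast_nonneg⟩
  refine ⟨hs.lim, hs.tendsto_lim hbdd, ?_⟩
  rw [Subadditive.lim]
  exact isGLB_csInf (Set.nonempty_Ici.image _) (hbdd.mono (Set.image_subset_range _ _))

lemma isLUB_image_const_sub {ι : Type*} {s : Set ι} {u : ι → ℝ} {a : ℝ} (h : IsGLB (u '' s) a)
    (c : ℝ) : IsLUB ((fun i => c - u i) '' s) (c - a) := by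
  have hdual := (OrderIso.subLeft c).isGLB_image'.2 h
  rw [Set.image_image] at hdual
  exact hdual

end Fekete

end AmbiguousSource

end

open AmbiguousSource in
theorem mainTheorem5 {V : Type u} [Fintype V] [MeasurableSpace V] [DiscreteMeasurableSpace V]
    (f : SpectralPoint.{u}) (G : SimpleGraph V)
    (μ : Measure (ℕ → V)) [IsProbabilityMeasure μ] (hμ : IsStationary μ) :
    -- `F(G^{⊠ n}, μ_{1…n})` is well defined
    (∀ n : ℕ, IsProbRefinement f (strongPow G n) (blockMarginal μ 0 n) (blockF f G μ n)) ∧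
    -- the `F`-rate exists and is the infimum
    Tendsto (fun n : ℕ => blockF f G μ n / n) atTop (𝓝 (FRate f G μ)) ∧
    IsGLB ((fun n : ℕ => blockF f G μ n / n) '' Set.Ici 1) (FRate f G μ) ∧
    -- the formulas in terms of the entropy rate
    Tendsto (fun n : ℕ => blockEntropy μ n / n) atTop (𝓝 (entropyRate μ)) ∧
    (∀ n : ℕ, 0 ≤ blockEntropy μ n - blockF f G μ n) ∧
    Tendsto (fun n : ℕ => (blockEntropy μ n - blockF f G μ n) / n) atTop
      (𝓝 (entropyRate μ - FRate f G μ)) ∧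
    IsGLB ((fun n : ℕ => (blockEntropy μ n - blockF f G μ n) / n) '' Set.Ici 1)
      (entropyRate μ - FRate f G μ) ∧
    IsLUB ((fun n : ℕ => entropyRate μ - (blockEntropy μ n - blockF f G μ n) / n) '' Set.Ici 1)
      (FRate f G μ) := by
  have hb_nonneg (n : ℕ) : 0 ≤ blockEntropy μ n - blockF f G μ n :=
    sub_nonneg.2 (blockF_le_blockEntropy μ f G n)
  obtain ⟨F, hF, hF_inf⟩ :=
    exists_tendsto_isGLB_of_subadditive (subadditive_blockF f G hμ) (blockF_nonneg μ f G)
  obtain ⟨b, hb, hb_inf⟩ := exists_tendsto_isGLB_of_subadditive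
    (subadditive_blockEntropy_sub_blockF f G hμ) hb_nonneg
  have hH : Tendsto (fun n : ℕ => blockEntropy μ n / n) atTop (𝓝 (F + b)) :=
    (hF.add hb).congr fun n => by rw [← add_div, add_sub_cancel]
  have hF_eq : FRate f G μ = F := hF.limUnder_eq
  have hH_eq : entropyRate μ = F + b := hH.limUnder_eq
  have hF_sup := isLUB_image_const_sub hb_inf (F + b)
  rw [add_sub_cancel_right] at hF_sup
  rw [hF_eq, hH_eq, add_sub_cancel_left]
  exact ⟨fun n => (isCountRate_blockF μ f G n).isProbRefinement, hF, hF_inf, hH, hb_nonneg, hb,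
    hb_inf, hF_sup⟩
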